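/- Let $M$ be a compact complex manifold of complex dimension $n\ge 2$ with a smooth Hermitian metric $g$, let $\omega=\sqrt{-1}\sum_{i,j} g_{i\bar j}\,dz^i\wedge d\bar z^j$ be its associated real $(1,1)$-form, and let $d\mu=\omega^n/\int_M\omega^n$. Let $A$ and $C$ be real constants. Then for every $\alpha>0$ there is a constant $C_\alpha$, depending only on $(M,g)$, $A$, $C$ and $\alpha$, such that the following holds. Let $\varphi:M\to\mathbb{R}$ be a smooth function with $\sup_M\varphi=0$ for which $g'_{i\bar j}=g_{i\bar j}+\partial_i\partial_{\bar j}\varphi$ is positive definite and which satisfies the second-order estimate $$\operatorname{tr}_g g' = g^{i\bar j}g'_{i\bar j}\le C\,e^{A(\varphi-\inf_M\varphi)}\quad\text{on } M.$$ Then $$-\inf_M\varphi\le C_\alpha+\frac1\alpha\log\int_M e^{-\alpha\varphi}\,d\mu .$$ -/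

import Mathlib

open MeasureTheory
open scoped ContDiff Manifold ComplexOrder

noncomputable section

namespace HermitianGeometry

/-- The model space `ℂⁿ` of an `n`-dimensional complex manifold. -/
abbrev CSpace (n : ℕ) : Type := EuclideanSpace ℂ (Fin n)

/-- The standard charted space structure of `ℂⁿ` over itself (a shortcut instance). -/
instance chartedSpaceCSpace (n : ℕ) : ChartedSpace (CSpace n) (CSpace n) := chartedSpaceSelf _

/-- The Wirtinger derivative `∂f/∂zⁱ = (∂f/∂xⁱ - √-1 ∂f/∂yⁱ) / 2`, where `zⁱ = xⁱ + √-1 yⁱ`. -/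
def dz {n : ℕ} (i : Fin n) (f : CSpace n → ℂ) (z : CSpace n) : ℂ :=
  (fderiv ℝ f z (EuclideanSpace.single i 1) - Complex.I * fderiv ℝ f z (EuclideanSpace.single i Complex.I)) / 2

/-- The Wirtinger derivative `∂f/∂z̄ⁱ = (∂f/∂xⁱ + √-1 ∂f/∂yⁱ) / 2`. -/
def dzbar {n : ℕ} (i : Fin n) (f : CSpace n → ℂ) (z : CSpace n) : ℂ :=
  (fderiv ℝ f z (EuclideanSpace.single i 1) + Complex.I * fderiv ℝ f z (EuclideanSpace.single i Complex.I)) / 2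

/-- A smooth Hermitian metric on the complex manifold `M`: a positive definite Hermitian form
`g(v, w)` on every holomorphic tangent space, linear in `v` and conjugate-linear in `w`, whose
coefficients `g_{i j̄} = g(∂_i, ∂_j)` are smooth functions in every holomorphic chart `e` of the
atlas. The coordinate field `∂_i` of `e` is the image of the `i`-th basis vector of `ℂⁿ` under
the differential of `e⁻¹`. -/
structure HermitianMetric (n : ℕ) (M : Type*) [TopologicalSpace M] [ChartedSpace (CSpace n) M] where
  form : ∀ p : M, TangentSpace 𝓘(ℂ, CSpace n) p →ₗ[ℂ] TangentSpace 𝓘(ℂ, CSpace n) p →ₗ⋆[ℂ] ℂ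
  conj_symm : ∀ (p : M) (v w : TangentSpace 𝓘(ℂ, CSpace n) p),
    starRingEnd ℂ (form p v w) = form p w v
  pos : ∀ (p : M) (v : TangentSpace 𝓘(ℂ, CSpace n) p), v ≠ 0 → 0 < (form p v v).re
  smooth : ∀ e ∈ atlas (CSpace n) M, ∀ i j : Fin n,
    ContDiffOn ℝ ∞ (fun z : CSpace n => form (e.symm z)
      (mfderiv 𝓘(ℂ, CSpace n) 𝓘(ℂ, CSpace n) e.symm z (EuclideanSpace.single i (1 : ℂ)))
      (mfderiv 𝓘(ℂ, CSpace n) 𝓘(ℂ, CSpace n) e.symm z (EuclideanSpace.single j (1 : ℂ))))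
      e.target

variable {n : ℕ} {M : Type*} [TopologicalSpace M] [ChartedSpace (CSpace n) M]

/-- The matrix `(g_{i j̄})` of the metric in the chart `e`, as a function of the coordinates. -/
def HermitianMetric.coeff (g : HermitianMetric n M) (e : OpenPartialHomeomorph M (CSpace n))
    (z : CSpace n) : Matrix (Fin n) (Fin n) ℂ :=
  Matrix.of fun i j => g.form (e.symm z)
    (mfderiv 𝓘(ℂ, CSpace n) 𝓘(ℂ, CSpace n) e.symm z (EuclideanSpace.single i (1 : ℂ)))
    (mfderiv 𝓘(ℂ, CSpace n) 𝓘(ℂ, CSpace n) e.symm z (EuclideanSpace.single j (1 : ℂ)))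

/-- The matrix `(∂_i ∂_{j̄} φ)` of the real function `φ` in the chart `e`. -/
def complexHessian (φ : M → ℝ) (e : OpenPartialHomeomorph M (CSpace n)) (z : CSpace n) :
    Matrix (Fin n) (Fin n) ℂ :=
  Matrix.of fun i j => dz i (dzbar j fun x => (φ (e.symm x) : ℂ)) z

/-- The matrix `g'_{i j̄} = g_{i j̄} + ∂_i ∂_{j̄} φ` in the chart `e`. -/
def HermitianMetric.deformedCoeff (g : HermitianMetric n M) (φ : M → ℝ)
    (e : OpenPartialHomeomorph M (CSpace n)) (z : CSpace n) : Matrix (Fin n) (Fin n) ℂ :=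
  g.coeff e z + complexHessian φ e z

/-- `ω + √-1 ∂∂̄φ > 0`: the matrix `(g'_{i j̄})` is positive definite at every point of every
chart of the atlas. -/
def HermitianMetric.IsAdmissible (g : HermitianMetric n M) (φ : M → ℝ) : Prop :=
  ∀ e ∈ atlas (CSpace n) M, ∀ z ∈ e.target, (g.deformedCoeff φ e z).PosDef

/-- The trace `tr_g g' = g^{i j̄} g'_{i j̄}` at `p`, a real number that does not depend on the
holomorphic chart around `p` in which it is computed. -/
def HermitianMetric.traceDeformed (g : HermitianMetric n M) (φ : M → ℝ) (p : M) : ℝ :=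
  (((g.coeff (chartAt (CSpace n) p) (chartAt (CSpace n) p p))⁻¹ *
    g.deformedCoeff φ (chartAt (CSpace n) p) (chartAt (CSpace n) p p)).trace).re

/-- The measure `ωⁿ` on the domain of one chart `e`, extended by zero to `M`. In coordinates, with
`ω = √-1 ∑ g_{i j̄} dzⁱ ∧ dz̄ʲ`, one has `ωⁿ = n! 2ⁿ det(g_{i j̄}) dx¹ dy¹ ⋯ dxⁿ dyⁿ`. -/
def HermitianMetric.localVolume [MeasurableSpace M] (g : HermitianMetric n M)
    (e : OpenPartialHomeomorph M (CSpace n)) : Measure M :=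
  (((volume : Measure (CSpace n)).restrict e.target).withDensity fun z =>
    ENNReal.ofReal ((n.factorial : ℝ) * 2 ^ n * (g.coeff e z).det.re)).map e.symm

/-- The measure `ωⁿ` on `M`. The local measures agree on overlaps of charts, so the global measure
they determine is their supremum in the lattice of measures. -/
def HermitianMetric.volumeMeasure [MeasurableSpace M] (g : HermitianMetric n M) : Measure M :=
  ⨆ e ∈ atlas (CSpace n) M, g.localVolume e

/-- The normalized measure `dμ = ωⁿ / ∫_M ωⁿ`. -/
def HermitianMetric.normalizedVolume [MeasurableSpace M] (g : HermitianMetric n M) : Measure M :=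
  (g.volumeMeasure Set.univ)⁻¹ • g.volumeMeasure

end HermitianGeometry

end

/-!
Let `m = inf φ` and `u = e^{-q(φ - m)}` with `q = max α A`. Positivity of `g'` gives
`∂∂̄φ ≤ (tr_g g' - 1) g`, so the second-order estimate bounds the coordinate Laplacian of `u` below
by a constant: the factor `e^{A(φ - m)}` is absorbed by `e^{-q(φ - m)}` because `q ≥ A`. Since
`u = 1` where `φ` attains its infimum, the sub-mean-value inequality on a coordinate ball around
that point bounds `∫ u ≤ ∫ e^{-α(φ - m)}` below by a positive constant independent of `φ`, uniformly
over the compact manifold. Taking logarithms gives the claim.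
-/

namespace HermitianGeometry

section SubMeanValue

open InnerProductSpace Laplacian

theorem hasDerivAt_max_zero_sq (s : ℝ) :
    HasDerivAt (fun x : ℝ => max x 0 ^ 2) (2 * max s 0) s := by
  have taylor : ∀ x : ℝ, ‖max x 0 ^ 2 - max s 0 ^ 2 - (x - s) * (2 * max s 0)‖ ≤ ‖‖x - s‖ ^ 2‖ := by
    intro x
    rw [Real.norm_eq_abs, norm_pow, norm_norm, Real.norm_eq_abs, sq_abs, abs_le]
    rcases max_cases x 0 with ⟨hx, hx'⟩ | ⟨hx, hx'⟩ <;>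
      rcases max_cases s 0 with ⟨hs, hs'⟩ | ⟨hs, hs'⟩ <;> rw [hx, hs] <;>
      constructor <;> nlinarith
  rw [hasDerivAt_iff_isLittleO]
  exact (Asymptotics.IsBigO.of_norm_le taylor).trans_isLittleO
    (Asymptotics.isLittleO_pow_sub_sub s one_lt_two).norm_left

theorem exists_contDiff_eventuallyEq_nhdsSet {E : Type*} [NormedAddCommGroup E] [NormedSpace ℝ E]
    [FiniteDimensional ℝ E] {k : ℕ} {u : E → ℝ} {K V : Set E} (hK : IsClosed K) (hV : IsOpen V)
    (hKV : K ⊆ V) (hu : ContDiffOn ℝ k u V) :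
    ∃ v : E → ℝ, ContDiff ℝ k v ∧ v =ᶠ[nhdsSet K] u := by
  obtain ⟨W, hWo, hKW, hWV⟩ := normal_exists_closure_subset hK hV hKV
  obtain ⟨χ, hχK, hχW, -⟩ := exists_contMDiffMap_one_nhds_of_subset_interior 𝓘(ℝ, E) (n := ⊤)
    hK (hKW.trans (interior_maximal subset_rfl hWo))
  refine ⟨fun x => χ x * u x, contDiff_iff_contDiffAt.2 fun x => ?_, ?_⟩
  · by_cases hx : x ∈ closure W
    · exact (χ.contMDiff.contDiff.contDiffAt.of_le (by exact_mod_cast le_top)).mul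
        (hu.contDiffAt (hV.mem_nhds (hWV hx)))
    · refine contDiffAt_const (c := (0 : ℝ)) |>.congr_of_eventuallyEq ?_
      filter_upwards [isClosed_closure.isOpen_compl.mem_nhds hx] with y hy
      rw [hχW y fun h => hy (subset_closure h), zero_mul]
  · filter_upwards [hχK] with x hx
    rw [hx, one_mul]

variable {E : Type*} [NormedAddCommGroup E]

/-- The radial weight `(1 - ‖w‖²)₊`, supported in the closed unit ball. It is chosen because
`w ↦ -4 * ballWeight w • w` is the gradient of its square, which turns radial derivatives of
averages against it into averages of the Laplacian. -/
def ballWeight (w : E) : ℝ := max (1 - ‖w‖ ^ 2) 0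

@[fun_prop]
theorem continuous_ballWeight : Continuous (ballWeight : E → ℝ) := by
  unfold ballWeight; fun_prop

theorem ballWeight_nonneg (w : E) : 0 ≤ ballWeight w := le_max_right _ _

theorem ballWeight_le_one (w : E) : ballWeight w ≤ 1 :=
  max_le (by linarith [sq_nonneg ‖w‖]) zero_le_one

theorem ballWeight_eq_zero {w : E} (hw : 1 ≤ ‖w‖) : ballWeight w = 0 :=
  max_eq_right (by nlinarith)

variable [InnerProductSpace ℝ E]

theorem hasFDerivAt_ballWeight_sq (w : E) :
    HasFDerivAt (fun w : E => ballWeight w ^ 2) (-(4 * ballWeight w) • innerSL ℝ w) w := by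
  have h : HasFDerivAt (fun x : E => 1 - ‖x‖ ^ 2) (-(2 • innerSL ℝ w)) w :=
    (hasStrictFDerivAt_norm_sq w).hasFDerivAt.const_sub 1
  refine ((hasDerivAt_max_zero_sq (1 - ‖w‖ ^ 2)).comp_hasFDerivAt w h).congr_fderiv ?_
  ext x
  simp [ballWeight]
  ring

variable [FiniteDimensional ℝ E]

theorem hasCompactSupport_ballWeight : HasCompactSupport (ballWeight : E → ℝ) :=
  have := FiniteDimensional.proper_real E
  HasCompactSupport.intro (isCompact_closedBall (0 : E) 1) fun w hw =>
    ballWeight_eq_zero (by simpa using (not_le.1 (by simpa using hw)).le)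

variable [MeasurableSpace E] [BorelSpace E] {μ : Measure E} [μ.IsAddHaarMeasure]

theorem integrable_ballWeight_mul {f : E → ℝ} (hf : Continuous f) :
    Integrable (fun w => ballWeight w * f w) μ :=
  (continuous_ballWeight.mul hf).integrable_of_hasCompactSupport
    hasCompactSupport_ballWeight.mul_right

theorem integrable_ballWeight_sq_mul {f : E → ℝ} (hf : Continuous f) :
    Integrable (fun w => ballWeight w ^ 2 * f w) μ := by
  simpa only [sq, mul_assoc] using
    integrable_ballWeight_mul (f := fun w => ballWeight w * f w) (continuous_ballWeight.mul hf)

theorem integral_ballWeight_pos : 0 < ∫ w : E, ballWeight w ∂μ :=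
  Continuous.integral_pos_of_hasCompactSupport_nonneg_nonzero (x := 0)
    continuous_ballWeight hasCompactSupport_ballWeight ballWeight_nonneg (by simp [ballWeight])

theorem integral_ballWeight_mul_inner_mul {h : E → ℝ} (hh : ContDiff ℝ 1 h) (v : E) :
    ∫ w, ballWeight w * (inner ℝ w v * h w) ∂μ =
      (1 / 4) * ∫ w, ballWeight w ^ 2 * fderiv ℝ h w v ∂μ := by
  have hh' : Continuous fun w => fderiv ℝ h w v :=
    (hh.continuous_fderiv one_ne_zero).clm_apply continuous_const
  have grad : ∀ w : E, fderiv ℝ (fun w : E => ballWeight w ^ 2) w v * h w =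
      -4 * (ballWeight w * (inner ℝ w v * h w)) := fun w => by
    simp only [(hasFDerivAt_ballWeight_sq w).fderiv, _root_.smul_apply, innerSL_apply_apply,
      smul_eq_mul]
    ring
  have parts := integral_mul_fderiv_eq_neg_fderiv_mul_of_integrable (μ := μ)
    (f := fun w : E => ballWeight w ^ 2) (g := h) (v := v)
    (by simpa only [grad] using
      (integrable_ballWeight_mul (f := fun w => inner ℝ w v * h w)
        (by have := hh.continuous; fun_prop)).const_mul (-4))
    (integrable_ballWeight_sq_mul hh') (integrable_ballWeight_sq_mul hh.continuous)
    (fun w _ => (hasFDerivAt_ballWeight_sq w).differentiableAt)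
    (fun w _ => hh.differentiable one_ne_zero w)
  simp only [grad, integral_const_mul] at parts
  linarith

theorem hasDerivAt_integral_ballWeight_mul {u : E → ℝ} (hu : ContDiff ℝ 1 u) (x : E) (t : ℝ) :
    HasDerivAt (fun t : ℝ => ∫ w, ballWeight w * u (x + t • w) ∂μ)
      (∫ w, ballWeight w * fderiv ℝ u (x + t • w) w ∂μ) t := by
  have := FiniteDimensional.proper_real E
  have hu' : Continuous fun y : ℝ × E => fderiv ℝ u (x + y.1 • y.2) y.2 := by
    have := hu.continuous_fderiv one_ne_zero
    fun_prop
  obtain ⟨B, hB⟩ := ((isCompact_closedBall t 1).prod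
    (isCompact_closedBall (0 : E) 1)).exists_bound_of_continuousOn hu'.continuousOn
  have dominated : ∀ w : E, ∀ s ∈ Metric.ball t 1,
      ‖ballWeight w * fderiv ℝ u (x + s • w) w‖ ≤ ballWeight w * B := by
    intro w s hs
    rcases le_total 1 ‖w‖ with hw | hw
    · simp [ballWeight_eq_zero hw]
    · rw [norm_mul, Real.norm_of_nonneg (ballWeight_nonneg w)]
      exact mul_le_mul_of_nonneg_left
        (hB (s, w) ⟨Metric.ball_subset_closedBall hs, by simpa using hw⟩) (ballWeight_nonneg w)
  have hasDeriv : ∀ (w : E) (s : ℝ), HasDerivAt (fun s : ℝ => ballWeight w * u (x + s • w))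
      (ballWeight w * fderiv ℝ u (x + s • w) w) s := fun w s => by
    have line : HasDerivAt (fun s : ℝ => x + s • w) w s := by
      simpa using ((hasDerivAt_id s).smul_const w).const_add x
    exact ((hu.differentiable one_ne_zero _).hasFDerivAt.comp_hasDerivAt s line).const_mul _
  have integrable : ∀ s : ℝ, Integrable (fun w => ballWeight w * u (x + s • w)) μ := fun s =>
    integrable_ballWeight_mul (by have := hu.continuous; fun_prop)
  exact (hasDerivAt_integral_of_dominated_loc_of_deriv_le (Metric.ball_mem_nhds t one_pos)
    (.of_forall fun s => (integrable s).aestronglyMeasurable) (integrable t)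
    (integrable_ballWeight_mul (hu'.comp (.prodMk_right t))).aestronglyMeasurable
    (.of_forall dominated) (integrable_ballWeight_mul continuous_const)
    (.of_forall fun w s _ => hasDeriv w s)).2

theorem integral_ballWeight_mul_fderiv {u : E → ℝ} (hu : ContDiff ℝ 2 u) (x : E) (t : ℝ) :
    ∫ w, ballWeight w * fderiv ℝ u (x + t • w) w ∂μ =
      t / 4 * ∫ w, ballWeight w ^ 2 * Δ u (x + t • w) ∂μ := by
  let b := stdOrthonormalBasis ℝ E
  let h := fun i w => fderiv ℝ u (x + t • w) (b i)
  have hu' : ContDiff ℝ 1 (fderiv ℝ u) := hu.fderiv_right (by norm_num)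
  have hh : ∀ i, ContDiff ℝ 1 (h i) := fun i => by fun_prop
  have hderiv : ∀ i w, fderiv ℝ (h i) w (b i) =
      t * iteratedFDeriv ℝ 2 u (x + t • w) ![b i, b i] := fun i w => by
    have line : HasFDerivAt (fun w : E => x + t • w) (t • ContinuousLinearMap.id ℝ E) w :=
      ((hasFDerivAt_id w).const_smul t).const_add x
    have := ((hu'.differentiable one_ne_zero _).hasFDerivAt.comp w line).clm_apply
      (hasFDerivAt_const (b i) w)
    rw [show fderiv ℝ (h i) w = _ from this.fderiv]
    simp [iteratedFDeriv_two_apply]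
  have hcont : ∀ i, Continuous fun w => fderiv ℝ (h i) w (b i) := fun i =>
    ((hh i).continuous_fderiv one_ne_zero).clm_apply continuous_const
  calc ∫ w, ballWeight w * fderiv ℝ u (x + t • w) w ∂μ
      = ∫ w, ∑ i, ballWeight w * (inner ℝ w (b i) * h i w) ∂μ := by
        congr 1 with w
        nth_rw 3 [← b.sum_repr' w]
        simp only [map_sum, map_smul, smul_eq_mul, Finset.mul_sum, real_inner_comm w, h]
    _ = ∑ i, 1 / 4 * ∫ w, ballWeight w ^ 2 * fderiv ℝ (h i) w (b i) ∂μ := by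
        rw [integral_finsetSum _ fun i _ => integrable_ballWeight_mul
          (by have := (hh i).continuous; fun_prop)]
        exact Finset.sum_congr rfl fun i _ => integral_ballWeight_mul_inner_mul (hh i) (b i)
    _ = t / 4 * ∫ w, ballWeight w ^ 2 * Δ u (x + t • w) ∂μ := by
        rw [← Finset.mul_sum, ← integral_finsetSum _ fun i _ =>
          integrable_ballWeight_sq_mul (hcont i), ← integral_const_mul, ← integral_const_mul]
        congr 1 with w
        simp only [hderiv, laplacian_eq_iteratedFDeriv_orthonormalBasis u b, Finset.mul_sum]
        exact Finset.sum_congr rfl fun i _ => by ring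

theorem mul_integral_ballWeight_le {u : E → ℝ} (hu : ContDiff ℝ 2 u) {x : E} {r K : ℝ}
    (hr : 0 ≤ r) (hK : 0 ≤ K) (hlap : ∀ y ∈ Metric.ball x r, -K ≤ Δ u y) :
    u x * ∫ w, ballWeight w ∂μ ≤
      ∫ w, ballWeight w * u (x + r • w) ∂μ + K * (∫ w, ballWeight w ∂μ) * r ^ 2 / 8 := by
  set I := ∫ w, ballWeight w ∂μ
  let Φ := fun t : ℝ => ∫ w, ballWeight w * u (x + t • w) ∂μ + K * I * t ^ 2 / 8
  have hΦ : ∀ t, HasDerivAt Φ (t / 4 * (∫ w, ballWeight w ^ 2 * Δ u (x + t • w) ∂μ + K * I)) t :=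
    fun t => by
      have h := hasDerivAt_integral_ballWeight_mul (μ := μ) (hu.of_le one_le_two) x t
      rw [integral_ballWeight_mul_fderiv hu] at h
      refine (h.add (((hasDerivAt_pow 2 t).const_mul (K * I)).div_const 8)).congr_deriv ?_
      push_cast
      ring
  have laplacian_ge : ∀ t ∈ Set.Ioo 0 r,
      -(K * I) ≤ ∫ w, ballWeight w ^ 2 * Δ u (x + t • w) ∂μ := fun t ht => by
    have hΔ : Continuous (Δ u) := by
      simp only [laplacian_eq_iteratedFDeriv_stdOrthonormalBasis]
      have := hu.continuous_iteratedFDeriv le_rfl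
      fun_prop
    rw [← neg_mul, ← integral_const_mul]
    refine integral_mono
      (by simpa only [mul_comm] using integrable_ballWeight_mul (continuous_const (y := -K)))
      (integrable_ballWeight_sq_mul (by fun_prop)) fun w => ?_
    rcases le_or_gt 1 ‖w‖ with hw | hw
    · simp [ballWeight_eq_zero hw]
    · have hy := hlap (x + t • w) (by
        rw [mem_ball_iff_norm, add_sub_cancel_left, norm_smul, Real.norm_of_nonneg ht.1.le]
        nlinarith [ht.1, ht.2, norm_nonneg w])
      nlinarith [mul_le_mul_of_nonneg_left hy (sq_nonneg (ballWeight w)),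
        mul_nonneg hK (mul_nonneg (ballWeight_nonneg w) (sub_nonneg.2 (ballWeight_le_one w)))]
  have mono : MonotoneOn Φ (Set.Icc 0 r) :=
    monotoneOn_of_hasDerivWithinAt_nonneg (convex_Icc 0 r)
      (fun t _ => (hΦ t).continuousAt.continuousWithinAt)
      (fun t _ => (hΦ t).hasDerivWithinAt) fun t ht => by
        rw [interior_Icc] at ht
        exact mul_nonneg (by linarith [ht.1]) (by linarith [laplacian_ge t ht])
  simpa [Φ, I, integral_mul_const, mul_comm (u x)] using
    mono (Set.left_mem_Icc.2 hr) (Set.right_mem_Icc.2 hr) hr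

theorem integral_ballWeight_mul_le {v : E → ℝ} (hv : Continuous v) {x : E} {r : ℝ} (hr : 0 < r)
    (hv0 : ∀ y ∈ Metric.closedBall x r, 0 ≤ v y) :
    ∫ w, ballWeight w * v (x + r • w) ∂μ ≤
      (r ^ Module.finrank ℝ E)⁻¹ * ∫ y in Metric.closedBall x r, v y ∂μ := by
  have := FiniteDimensional.proper_real E
  have hmeas : MeasurableSet (Metric.closedBall x r) := Metric.isClosed_closedBall.measurableSet
  set F := (Metric.closedBall x r).indicator v with hFdef
  have hF : Integrable F μ :=
    (hv.continuousOn.integrableOn_compact (isCompact_closedBall x r)).integrable_indicator hmeas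
  have le_F : ∀ w, ballWeight w * v (x + r • w) ≤ F (x + r • w) := fun w => by
    rcases le_or_gt ‖w‖ 1 with hw | hw
    · have hy : x + r • w ∈ Metric.closedBall x r := by
        rw [mem_closedBall_iff_norm, add_sub_cancel_left, norm_smul, Real.norm_of_nonneg hr.le]
        exact mul_le_of_le_one_right hr.le hw
      rw [hFdef, Set.indicator_of_mem hy]
      exact mul_le_of_le_one_left (hv0 _ hy) (ballWeight_le_one w)
    · rw [ballWeight_eq_zero hw.le, zero_mul]
      exact Set.indicator_nonneg hv0 _
  calc ∫ w, ballWeight w * v (x + r • w) ∂μ ≤ ∫ w, F (x + r • w) ∂μ :=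
        integral_mono (integrable_ballWeight_mul (by fun_prop))
          ((hF.comp_add_left x).comp_smul hr.ne') le_F
    _ = (r ^ Module.finrank ℝ E)⁻¹ * ∫ y in Metric.closedBall x r, v y ∂μ := by
        rw [Measure.integral_comp_smul_of_nonneg μ (fun y => F (x + y)) r (hR := hr.le),
          integral_add_left_eq_self F x, integral_indicator hmeas, smul_eq_mul]

theorem mul_sub_le_setIntegral_closedBall_of_le_laplacian {u : E → ℝ} {V : Set E} {x : E}
    {r K : ℝ} (hV : IsOpen V) (hu : ContDiffOn ℝ 2 u V) (hxV : Metric.closedBall x r ⊆ V)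
    (hr : 0 < r) (hK : 0 ≤ K) (hu0 : ∀ y ∈ Metric.closedBall x r, 0 ≤ u y)
    (hlap : ∀ y ∈ Metric.ball x r, -K ≤ Δ u y) :
    r ^ Module.finrank ℝ E * (∫ w, ballWeight w ∂μ) * (u x - K * r ^ 2 / 8) ≤
      ∫ y in Metric.closedBall x r, u y ∂μ := by
  obtain ⟨v, hv, hvu⟩ := exists_contDiff_eventuallyEq_nhdsSet (k := 2)
    Metric.isClosed_closedBall hV hxV hu
  have hvu' : Set.EqOn v u (Metric.closedBall x r) := hvu.self_of_nhdsSet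
  have hlap' : ∀ y ∈ Metric.ball x r, -K ≤ Δ v y := fun y hy => by
    have hy' := Metric.ball_subset_closedBall hy
    rw [(laplacian_congr_nhds (eventually_nhdsSet_iff_forall.1 hvu y hy')).self_of_nhds]
    exact hlap y hy
  have mean := (mul_integral_ballWeight_le (μ := μ) hv hr.le hK hlap').trans (add_le_add_left
    (integral_ballWeight_mul_le hv.continuous hr fun y hy => (hu0 y hy).trans_eq (hvu' hy).symm) _)
  rw [hvu' (Metric.mem_closedBall_self hr.le), ← sub_le_iff_le_add,
    le_inv_mul_iff₀ (by positivity),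
    setIntegral_congr_fun Metric.isClosed_closedBall.measurableSet hvu'] at mean
  linarith

variable (μ) in
theorem exists_pos_le_setIntegral_closedBall (p : E) {R K : ℝ} (hR : 0 < R) (hK : 0 ≤ K) :
    ∃ c : ℝ, 0 < c ∧ ∀ (u : E → ℝ) (V : Set E), IsOpen V → Metric.closedBall p R ⊆ V →
      ContDiffOn ℝ 2 u V → (∀ y ∈ Metric.closedBall p R, 0 ≤ u y) →
      (∀ y ∈ Metric.closedBall p R, -K ≤ Δ u y) →
      ∀ x ∈ Metric.closedBall p (R / 2), 1 ≤ u x →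
        c ≤ ∫ y in Metric.closedBall p R, u y ∂μ := by
  set r := min (R / 2) (K + 1)⁻¹
  have hr : 0 < r := by positivity
  have hKr : K * r ^ 2 ≤ 1 := by
    have hrK : r * (K + 1) ≤ 1 :=
      (le_div_iff₀ (by positivity)).1 ((min_le_right _ _).trans_eq (one_div _).symm)
    nlinarith
  have hI : 0 < ∫ w : E, ballWeight w ∂μ := integral_ballWeight_pos
  refine ⟨r ^ Module.finrank ℝ E * (∫ w, ballWeight w ∂μ) * (1 / 2), by positivity,
    fun u V hV hRV hu hu0 hlap x hx hux => ?_⟩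
  have hsub : Metric.closedBall x r ⊆ Metric.closedBall p R :=
    Metric.closedBall_subset_closedBall'
      ((add_le_add (min_le_left _ _) (Metric.mem_closedBall.1 hx)).trans_eq (add_halves R))
  calc r ^ Module.finrank ℝ E * (∫ w, ballWeight w ∂μ) * (1 / 2)
      ≤ r ^ Module.finrank ℝ E * (∫ w, ballWeight w ∂μ) * (u x - K * r ^ 2 / 8) := by
        gcongr
        linarith
    _ ≤ ∫ y in Metric.closedBall x r, u y ∂μ :=
        mul_sub_le_setIntegral_closedBall_of_le_laplacian hV hu (hsub.trans hRV) hr hK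
          (fun y hy => hu0 y (hsub hy))
          fun y hy => hlap y (hsub (Metric.ball_subset_closedBall hy))
    _ ≤ ∫ y in Metric.closedBall p R, u y ∂μ :=
        setIntegral_mono_set ((hu.continuousOn.mono hRV).integrableOn_compact
          (isCompact_closedBall p R))
          ((ae_restrict_mem Metric.isClosed_closedBall.measurableSet).mono hu0)
          hsub.eventuallyLE

end SubMeanValue

section TraceBound

open Matrix
open scoped MatrixOrder

variable {m 𝕜 : Type*} [Fintype m] [DecidableEq m] [RCLike 𝕜]

theorem posSemidef_le_trace_smul_one {S : Matrix m m 𝕜} (hS : S.PosSemidef) :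
    S ≤ RCLike.re S.trace • (1 : Matrix m m 𝕜) := by
  rw [← Algebra.algebraMap_eq_smul_one]
  refine le_algebraMap_of_spectrum_le (fun x hx => ?_) hS.isHermitian.isSelfAdjoint
  rw [hS.isHermitian.spectrum_real_eq_range_eigenvalues] at hx
  obtain ⟨i, rfl⟩ := hx
  rw [hS.isHermitian.trace_eq_sum_eigenvalues, map_sum]
  simpa only [RCLike.ofReal_re] using
    Finset.single_le_sum (fun j _ => hS.eigenvalues_nonneg j) (Finset.mem_univ i)

theorem posSemidef_le_trace_inv_mul_smul {G G' : Matrix m m 𝕜} (hG : G.PosDef)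
    (hG' : G'.PosSemidef) : G' ≤ RCLike.re (G⁻¹ * G').trace • G := by
  set R := CFC.sqrt G
  have hRR : R * R = G := CFC.sqrt_mul_sqrt_self G hG.posSemidef.nonneg
  have hR : Rᴴ = R := (CFC.sqrt_nonneg G).posSemidef.isHermitian
  have hRunit : IsUnit R.det := (isUnit_iff_isUnit_det R).1 <|
    isUnit_of_mul_isUnit_left (hRR ▸ hG.isUnit)
  have htrace : (R⁻¹ * G' * R⁻¹).trace = (G⁻¹ * G').trace := by
    rw [trace_mul_comm, ← mul_assoc, ← Matrix.mul_inv_rev, hRR]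
  have hS : (R⁻¹ * G' * R⁻¹).PosSemidef := by
    simpa only [conjTranspose_nonsing_inv, hR] using hG'.conjTranspose_mul_mul_same R⁻¹
  have hconj := star_left_conjugate_le_conjugate (posSemidef_le_trace_smul_one hS) R
  rwa [htrace, star_eq_conjTranspose, hR, mul_assoc R⁻¹, mul_nonsing_inv_cancel_left _ _ hRunit,
    nonsing_inv_mul_cancel_right _ _ hRunit, mul_smul_comm, mul_one, smul_mul_assoc, hRR] at hconj

theorem re_dotProduct_mulVec_le {G G' : Matrix m m 𝕜} (hG : G.PosDef) (hG' : G'.PosSemidef)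
    (x : m → 𝕜) :
    RCLike.re (star x ⬝ᵥ G' *ᵥ x) ≤
      RCLike.re (G⁻¹ * G').trace * RCLike.re (star x ⬝ᵥ G *ᵥ x) := by
  have h := (le_iff.1 (posSemidef_le_trace_inv_mul_smul hG hG')).re_dotProduct_nonneg x
  rw [sub_mulVec, smul_mulVec, dotProduct_sub, dotProduct_smul, map_sub, RCLike.smul_re] at h
  linarith

end TraceBound

section Sesquilinear

open scoped Matrix

variable {n : ℕ}

theorem sesquilinear_apply_eq_sum (B : CSpace n →ₗ[ℂ] CSpace n →ₗ⋆[ℂ] ℂ) (v w : CSpace n) :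
    B v w = ∑ i, ∑ j, v i * starRingEnd ℂ (w j) *
      B (EuclideanSpace.single i 1) (EuclideanSpace.single j 1) := by
  let b := (EuclideanSpace.basisFun (Fin n) ℂ).toBasis
  rw [← LinearMap.sum_repr_mul_repr_mulₛₗ b b v w]
  simp [b, Finsupp.sum_fintype, mul_assoc]

theorem dotProduct_mulVec_star_eq_sum (A : Matrix (Fin n) (Fin n) ℂ) (v : CSpace n) :
    v.ofLp ⬝ᵥ A *ᵥ star v.ofLp = ∑ i, ∑ j, v i * starRingEnd ℂ (v j) * A i j := by
  simp only [dotProduct, Matrix.mulVec, Finset.mul_sum, Pi.star_apply, ← starRingEnd_apply]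
  exact Finset.sum_congr rfl fun i _ => Finset.sum_congr rfl fun j _ => by ring

theorem det_sesquilinear_comp (B : CSpace n →ₗ[ℂ] CSpace n →ₗ⋆[ℂ] ℂ) (L : CSpace n →ₗ[ℂ] CSpace n) :
    (Matrix.of fun i j => B (L (EuclideanSpace.single i 1)) (L (EuclideanSpace.single j 1))).det =
      Complex.normSq (LinearMap.det L) * (Matrix.of fun i j =>
        B (EuclideanSpace.single i 1) (EuclideanSpace.single j 1)).det := by
  let b := (EuclideanSpace.basisFun (Fin n) ℂ).toBasis
  let J := LinearMap.toMatrix b b L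
  have congruence : (Matrix.of fun i j =>
      B (L (EuclideanSpace.single i 1)) (L (EuclideanSpace.single j 1))) =
      J.transpose * (Matrix.of fun i j =>
        B (EuclideanSpace.single i 1) (EuclideanSpace.single j 1)) * J.map (starRingEnd ℂ) := by
    ext i j
    simp only [Matrix.mul_apply, Matrix.transpose_apply, Matrix.map_apply, Finset.sum_mul,
      Matrix.of_apply, sesquilinear_apply_eq_sum B (L _)]
    rw [Finset.sum_comm]
    refine Finset.sum_congr rfl fun k _ => Finset.sum_congr rfl fun l _ => ?_
    simp [J, b, LinearMap.toMatrix_apply]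
    ring
  rw [congruence, Matrix.det_mul, Matrix.det_mul, Matrix.det_transpose,
    ← RingHom.mapMatrix_apply, ← RingHom.map_det, LinearMap.det_toMatrix, ← Complex.mul_conj]
  ring

end Sesquilinear

section LeviForm

section SecondDerivative

variable {𝕜 E F G : Type*} [NontriviallyNormedField 𝕜] [NormedAddCommGroup E] [NormedSpace 𝕜 E]
  [NormedAddCommGroup F] [NormedSpace 𝕜 F] [NormedAddCommGroup G] [NormedSpace 𝕜 G]

theorem hasFDerivAt_fderiv {f : E → F} {z : E} (hf : ContDiffAt 𝕜 2 f z) :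
    HasFDerivAt (fderiv 𝕜 f) (fderiv 𝕜 (fderiv 𝕜 f) z) z :=
  ((hf.fderiv_right (m := 1) (by norm_num)).differentiableAt one_ne_zero).hasFDerivAt

theorem eventually_differentiableAt {f : E → F} {z : E} (hf : ContDiffAt 𝕜 2 f z) :
    ∀ᶠ y in nhds z, DifferentiableAt 𝕜 f y :=
  (hf.eventually (by simp)).mono fun _ hy => hy.differentiableAt two_ne_zero

theorem fderiv_fderiv_comp {g : F → G} {f : E → F} {z : E} (hg : ContDiffAt 𝕜 2 g (f z))
    (hf : ContDiffAt 𝕜 2 f z) (v w : E) :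
    fderiv 𝕜 (fderiv 𝕜 (g ∘ f)) z v w =
      fderiv 𝕜 (fderiv 𝕜 g) (f z) (fderiv 𝕜 f z v) (fderiv 𝕜 f z w) +
        fderiv 𝕜 g (f z) (fderiv 𝕜 (fderiv 𝕜 f) z v w) := by
  have chain : fderiv 𝕜 (g ∘ f) =ᶠ[nhds z] fun y => (fderiv 𝕜 g (f y)).comp (fderiv 𝕜 f y) := by
    filter_upwards [eventually_differentiableAt hf,
      hf.continuousAt.eventually (eventually_differentiableAt hg)] with y hfy hgy
    exact fderiv_comp y hgy hfy
  have outer := (hasFDerivAt_fderiv hg).comp z (hf.differentiableAt two_ne_zero).hasFDerivAt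
  rw [((outer.clm_comp (hasFDerivAt_fderiv hf)).congr_of_eventuallyEq chain).fderiv]
  simp [add_comm]

theorem fderiv_fderiv_restrictScalars [NormedSpace ℝ E] [NormedSpace ℂ E] [IsScalarTower ℝ ℂ E]
    [NormedSpace ℝ F] [NormedSpace ℂ F] [IsScalarTower ℝ ℂ F] {f : E → F} {z : E}
    (hf : ContDiffAt ℂ 2 f z) (v w : E) :
    fderiv ℝ (fderiv ℝ f) z v w = fderiv ℂ (fderiv ℂ f) z v w := by
  have restrict : fderiv ℝ f =ᶠ[nhds z] fun y => (fderiv ℂ f y).restrictScalars ℝ :=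
    (eventually_differentiableAt hf).mono fun y hy => hy.fderiv_restrictScalars ℝ
  rw [(((ContinuousLinearMap.restrictScalarsL ℂ E F ℝ ℝ).hasFDerivAt.comp z
    ((hasFDerivAt_fderiv hf).restrictScalars ℝ)).congr_of_eventuallyEq restrict).fderiv]
  rfl

end SecondDerivative

variable {E E' F F' : Type*} [NormedAddCommGroup E] [NormedSpace ℝ E] [NormedSpace ℂ E]
  [NormedAddCommGroup E'] [NormedSpace ℝ E'] [NormedSpace ℂ E']
  [NormedAddCommGroup F] [NormedSpace ℝ F] [NormedAddCommGroup F'] [NormedSpace ℝ F']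

/-- The Levi form `∂∂̄f(v, v̄) = (D²f(v, v) + D²f(√-1 v, √-1 v)) / 4` of `f` at `z`. -/
noncomputable def leviForm (f : E → F) (z v : E) : F :=
  (1 / 4 : ℝ) • (fderiv ℝ (fderiv ℝ f) z v v +
    fderiv ℝ (fderiv ℝ f) z (Complex.I • v) (Complex.I • v))

theorem leviForm_comp [IsScalarTower ℝ ℂ E] [IsScalarTower ℝ ℂ E'] {f : E' → F} {h : E → E'}
    {z : E} (hf : ContDiffAt ℝ 2 f (h z)) (hh : ContDiffAt ℂ 2 h z) (v : E) :
    leviForm (f ∘ h) z v = leviForm f (h z) (fderiv ℂ h z v) := by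
  simp only [leviForm, fderiv_fderiv_comp hf (hh.restrict_scalars ℝ),
    fderiv_fderiv_restrictScalars hh,
    (hh.differentiableAt two_ne_zero).fderiv_restrictScalars ℝ,
    ContinuousLinearMap.coe_restrictScalars', map_smul, _root_.smul_apply, smul_smul,
    Complex.I_mul_I, neg_one_smul, map_neg]
  abel_nf

theorem leviForm_clm_comp {f : E → F} {z : E} (hf : ContDiffAt ℝ 2 f z) (L : F →L[ℝ] F') (v : E) :
    leviForm (L ∘ f) z v = L (leviForm f z v) := by
  have hL : fderiv ℝ L = fun _ => L := funext fun _ => L.fderiv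
  simp [leviForm, fderiv_fderiv_comp L.contDiff.contDiffAt hf, hL]

theorem deriv_mul_leviForm_le_leviForm_comp {f : E → ℝ} {h : ℝ → ℝ} {z : E}
    (hh : ContDiffAt ℝ 2 h (f z)) (hf : ContDiffAt ℝ 2 f z) (hconv : 0 ≤ deriv (deriv h) (f z))
    (v : E) : deriv h (f z) * leviForm f z v ≤ leviForm (h ∘ f) z v := by
  have hh2 : deriv (deriv h) (f z) = deriv (fderiv ℝ h) (f z) 1 := by
    simpa using ((hasFDerivAt_fderiv hh).hasDerivAt.clm_apply (hasDerivAt_const (f z) 1)).deriv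
  have second : ∀ a : ℝ, fderiv ℝ (fderiv ℝ h) (f z) a a = a ^ 2 * deriv (deriv h) (f z) :=
    fun a => by
      rw [fderiv_eq_smul_deriv, hh2, _root_.smul_apply, ← mul_one a, ← smul_eq_mul, map_smul]
      simp only [smul_eq_mul]
      ring
  have first : ∀ a : ℝ, fderiv ℝ h (f z) a = a * deriv h (f z) := fun a => fderiv_eq_smul_deriv a
  simp only [leviForm, fderiv_fderiv_comp hh hf, second, first, smul_eq_mul]
  nlinarith [mul_nonneg (sq_nonneg (fderiv ℝ f z v)) hconv,
    mul_nonneg (sq_nonneg (fderiv ℝ f z (Complex.I • v))) hconv]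

theorem smul_eq_re_smul_add_im_smul [IsScalarTower ℝ ℂ E] (c : ℂ) (v : E) :
    c • v = c.re • v + c.im • (Complex.I • v) := by
  rw [← algebraMap_smul ℂ c.re v, ← algebraMap_smul ℂ c.im, smul_smul, ← add_smul,
    Complex.coe_algebraMap, Complex.re_add_im]

theorem I_smul_smul_eq [IsScalarTower ℝ ℂ E] (c : ℂ) (v : E) :
    Complex.I • c • v = c.re • (Complex.I • v) - c.im • v := by
  rw [smul_comm, smul_eq_re_smul_add_im_smul c, smul_smul Complex.I, Complex.I_mul_I,
    neg_one_smul, smul_neg, sub_eq_add_neg]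

/-- The sesquilinear form
`(v, w) ↦ (B(v, w) + B(√-1 v, √-1 w) + √-1 (B(v, √-1 w) - B(√-1 v, w))) / 4` obtained from a
real bilinear form `B`; for `B = D²f` its coefficients in the standard basis are the
`∂_i ∂_{j̄} f`. -/
noncomputable def sesquilinearPart [IsScalarTower ℝ ℂ E] (B : E →L[ℝ] E →L[ℝ] ℂ) :
    E →ₗ[ℂ] E →ₗ⋆[ℂ] ℂ :=
  LinearMap.mk₂'ₛₗ (RingHom.id ℂ) (starRingEnd ℂ)
    (fun v w => (B v w + B (Complex.I • v) (Complex.I • w) +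
      Complex.I * (B v (Complex.I • w) - B (Complex.I • v) w)) / 4)
    (fun _ _ _ => by simp only [smul_add, map_add, _root_.add_apply]; ring)
    (fun c v w => by
      simp only [I_smul_smul_eq c v]
      simp only [smul_eq_re_smul_add_im_smul c v, map_add, map_sub, map_smul,
        _root_.add_apply, _root_.sub_apply, _root_.smul_apply, Complex.real_smul, RingHom.id_apply,
        smul_eq_mul]
      conv_rhs => rw [← Complex.re_add_im c]
      linear_combination
        (-(c.im : ℂ) * (B v (Complex.I • w) - B (Complex.I • v) w) / 4) * Complex.I_sq)
    (fun _ _ _ => by simp only [smul_add, map_add]; ring)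
    (fun c v w => by
      simp only [I_smul_smul_eq c w]
      simp only [smul_eq_re_smul_add_im_smul c w, map_add, map_sub, map_smul, Complex.real_smul,
        smul_eq_mul]
      conv_rhs => rw [← Complex.re_add_im c]
      simp only [map_add, map_mul, Complex.conj_ofReal, Complex.conj_I]
      linear_combination
        ((c.im : ℂ) * (B v (Complex.I • w) - B (Complex.I • v) w) / 4) * Complex.I_sq)

theorem sesquilinearPart_fderiv_fderiv_self [IsScalarTower ℝ ℂ E] {f : E → ℂ} {z : E}
    (hf : ContDiffAt ℝ 2 f z) (v : E) :
    sesquilinearPart (fderiv ℝ (fderiv ℝ f) z) v v = leviForm f z v := by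
  have hsymm := (hf.isSymmSndFDerivAt (by simp)) v (Complex.I • v)
  simp only [sesquilinearPart, LinearMap.mk₂'ₛₗ_apply, leviForm, hsymm, sub_self, mul_zero,
    add_zero, Complex.real_smul]
  push_cast
  ring

variable {n : ℕ}

theorem single_I (i : Fin n) :
    (EuclideanSpace.single i Complex.I : CSpace n) = Complex.I • EuclideanSpace.single i 1 := by
  ext j
  by_cases h : j = i <;> simp [h]

theorem dz_dzbar_eq_sesquilinearPart {f : CSpace n → ℂ} {z : CSpace n} (hf : ContDiffAt ℝ 2 f z)
    (i j : Fin n) :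
    dz i (dzbar j f) z = sesquilinearPart (fderiv ℝ (fderiv ℝ f) z)
      (EuclideanSpace.single i 1) (EuclideanSpace.single j 1) := by
  have hderiv : ∀ v : CSpace n, HasFDerivAt (fun y => fderiv ℝ f y v)
      ((fderiv ℝ (fderiv ℝ f) z).flip v) z := fun v => by
    refine ((hasFDerivAt_fderiv hf).clm_apply (hasFDerivAt_const v z)).congr_fderiv ?_
    ext a
    simp
  have hdzbar := ((hderiv (EuclideanSpace.single j 1)).add
    ((hderiv (EuclideanSpace.single j Complex.I)).const_mul Complex.I)).mul_const (2⁻¹ : ℂ)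
  rw [dz, show fderiv ℝ (dzbar j f) z = _ from hdzbar.fderiv]
  simp only [single_I, smul_add, _root_.add_apply, _root_.smul_apply,
    ContinuousLinearMap.flip_apply, smul_eq_mul, sesquilinearPart, LinearMap.mk₂'ₛₗ_apply]
  linear_combination (-fderiv ℝ (fderiv ℝ f) z (Complex.I • EuclideanSpace.single i 1)
    (Complex.I • EuclideanSpace.single j 1) / 4) * Complex.I_sq

theorem sum_mul_dz_dzbar_eq_leviForm {f : CSpace n → ℂ} {z : CSpace n} (hf : ContDiffAt ℝ 2 f z)
    (v : CSpace n) :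
    ∑ i, ∑ j, v i * starRingEnd ℂ (v j) * dz i (dzbar j f) z = leviForm f z v := by
  simp only [← sesquilinearPart_fderiv_fderiv_self hf, sesquilinear_apply_eq_sum _ v v,
    dz_dzbar_eq_sesquilinearPart hf]

open InnerProductSpace Laplacian in
theorem laplacian_eq_sum_leviForm (u : CSpace n → F) (z : CSpace n) :
    Δ u z = (4 : ℝ) • ∑ i, leviForm u z (EuclideanSpace.single i 1) := by
  let b := Pi.orthonormalBasis (fun _ : Fin n => Complex.orthonormalBasisOneI)
  rw [laplacian_eq_iteratedFDeriv_orthonormalBasis u b]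
  simp [iteratedFDeriv_two_apply, b, leviForm, Fintype.sum_sigma, Fin.sum_univ_two, single_I,
    Finset.smul_sum]

end LeviForm

section Charts

open scoped Matrix

variable {n : ℕ} {M : Type*} [TopologicalSpace M] [ChartedSpace (CSpace n) M]

/-- The form `g` pulled back to coordinates by the inverse of the chart `e`. -/
noncomputable def HermitianMetric.coordForm (g : HermitianMetric n M)
    (e : OpenPartialHomeomorph M (CSpace n)) (z : CSpace n) : CSpace n →ₗ[ℂ] CSpace n →ₗ⋆[ℂ] ℂ :=
  let L : CSpace n →ₗ[ℂ] CSpace n := (mfderiv 𝓘(ℂ, CSpace n) 𝓘(ℂ, CSpace n) e.symm z).toLinearMap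
  ((g.form (e.symm z)).comp L).compl₂ L

theorem HermitianMetric.coeff_eq_of_coordForm (g : HermitianMetric n M)
    (e : OpenPartialHomeomorph M (CSpace n)) (z : CSpace n) :
    g.coeff e z = Matrix.of fun i j =>
      g.coordForm e z (EuclideanSpace.single i 1) (EuclideanSpace.single j 1) :=
  rfl

theorem HermitianMetric.dotProduct_coeff_mulVec_star (g : HermitianMetric n M)
    (e : OpenPartialHomeomorph M (CSpace n)) (z v : CSpace n) :
    v.ofLp ⬝ᵥ g.coeff e z *ᵥ star v.ofLp = g.coordForm e z v v := by
  rw [dotProduct_mulVec_star_eq_sum, sesquilinear_apply_eq_sum]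
  rfl

theorem comp_symm_eventuallyEq_comp_transition {X Y Z : Type*} [TopologicalSpace X]
    [TopologicalSpace Y] {e e' : OpenPartialHomeomorph X Y} (f : X → Z) {z : Y}
    (hz : z ∈ (e.symm.trans e').source) :
    f ∘ e.symm =ᶠ[nhds z] (f ∘ e'.symm) ∘ e.symm.trans e' := by
  filter_upwards [(e.symm.trans e').open_source.mem_nhds hz] with x hx
  have hx' : e.symm x ∈ e'.source := (e.symm.trans_source e' ▸ hx).2
  simp [hx']

section Manifold

variable [IsManifold 𝓘(ℂ, CSpace n) ω M] {e e' : OpenPartialHomeomorph M (CSpace n)}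

theorem contDiffAt_transition (he : e ∈ atlas (CSpace n) M) (he' : e' ∈ atlas (CSpace n) M)
    {z : CSpace n} (hz : z ∈ (e.symm.trans e').source) :
    ContDiffAt ℂ ω (e.symm.trans e') z :=
  ((contMDiffOn_of_mem_contDiffGroupoid
    ((contDiffGroupoid ω 𝓘(ℂ, CSpace n)).compatible he he')).contDiffOn z hz).contDiffAt
      ((e.symm.trans e').open_source.mem_nhds hz)

theorem isManifold_restrictScalars (m : WithTop ℕ∞) : IsManifold 𝓘(ℝ, CSpace n) m M := by
  refine isManifold_of_contDiffOn _ _ _ fun e e' he he' z hz => ?_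
  have hz : z ∈ (e.symm.trans e').source := by simpa using hz
  exact (((contDiffAt_transition he he' hz).restrict_scalars ℝ).of_le le_top).contDiffWithinAt

theorem contDiffAt_comp_chart_symm {F : Type*} [NormedAddCommGroup F] [NormedSpace ℝ F]
    {m : WithTop ℕ∞} {φ : M → F} (hφ : ContMDiff 𝓘(ℝ, CSpace n) 𝓘(ℝ, F) m φ)
    (he : e ∈ atlas (CSpace n) M) {z : CSpace n} (hz : z ∈ e.target) :
    ContDiffAt ℝ m (φ ∘ e.symm) z := by
  have := isManifold_restrictScalars (n := n) (M := M) m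
  exact ((hφ.comp_contMDiffOn (contMDiffOn_symm_of_mem_maximalAtlas
    (IsManifold.subset_maximalAtlas he))).contDiffOn z hz).contDiffAt (e.open_target.mem_nhds hz)

variable (g : HermitianMetric n M)

theorem HermitianMetric.coordForm_transition (he : e ∈ atlas (CSpace n) M)
    (he' : e' ∈ atlas (CSpace n) M) {z : CSpace n} (hz : z ∈ (e.symm.trans e').source)
    (v w : CSpace n) :
    g.coordForm e z v w = g.coordForm e' (e.symm.trans e' z)
      (fderiv ℂ (e.symm.trans e') z v) (fderiv ℂ (e.symm.trans e') z w) := by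
  have hsymm : e.symm =ᶠ[nhds z] e'.symm ∘ e.symm.trans e' :=
    comp_symm_eventuallyEq_comp_transition id hz
  have chain := (((mdifferentiable_of_mem_atlas (I := 𝓘(ℂ, CSpace n)) he').mdifferentiableAt_symm
    ((e.symm.trans e').map_source hz).1).hasMFDerivAt.comp z
      ((contDiffAt_transition he he' hz).differentiableAt
        (by simp)).hasFDerivAt.hasMFDerivAt).congr_of_eventuallyEq hsymm
  have form_congr : ∀ p q : M, p = q → ∀ a b : CSpace n,
      (g.form p : CSpace n →ₗ[ℂ] CSpace n →ₗ⋆[ℂ] ℂ) a b =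
        (g.form q : CSpace n →ₗ[ℂ] CSpace n →ₗ⋆[ℂ] ℂ) a b := by
    rintro p _ rfl a b
    rfl
  unfold HermitianMetric.coordForm
  rw [chain.mfderiv]
  exact form_congr _ _ hsymm.eq_of_nhds _ _

theorem HermitianMetric.coordForm_self_pos (he : e ∈ atlas (CSpace n) M) {z : CSpace n}
    (hz : z ∈ e.target) {v : CSpace n} (hv : v ≠ 0) : 0 < g.coordForm e z v v := by
  have inj := (mdifferentiable_of_mem_atlas (I := 𝓘(ℂ, CSpace n)) he).symm.mfderiv_injective hz
  have hpos := g.pos (e.symm z) _ ((map_ne_zero_iff _ inj).2 hv)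
  exact Complex.lt_def.2 ⟨hpos, (Complex.conj_eq_iff_im.1 (g.conj_symm _ _ _)).symm⟩

theorem HermitianMetric.posDef_coeff (he : e ∈ atlas (CSpace n) M) {z : CSpace n}
    (hz : z ∈ e.target) : (g.coeff e z).PosDef := by
  refine Matrix.PosDef.of_dotProduct_mulVec_pos (Matrix.ext fun i j => g.conj_symm _ _ _)
    fun x hx => ?_
  have hpos := g.coordForm_self_pos he hz (v := WithLp.toLp 2 (star x)) (by simpa using hx)
  rwa [← g.dotProduct_coeff_mulVec_star, star_star] at hpos

theorem HermitianMetric.det_coeff_transition (he : e ∈ atlas (CSpace n) M)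
    (he' : e' ∈ atlas (CSpace n) M) {z : CSpace n} (hz : z ∈ (e.symm.trans e').source) :
    (g.coeff e z).det.re = |((fderiv ℂ (e.symm.trans e') z).restrictScalars ℝ).det| *
      (g.coeff e' (e.symm.trans e' z)).det.re := by
  set L := fderiv ℂ (e.symm.trans e') z with hL
  have real_det : (L.restrictScalars ℝ).det = Complex.normSq (LinearMap.det L.toLinearMap) := by
    rw [← Algebra.norm_complex_apply, ← LinearMap.det_restrictScalars]
    rfl
  simp only [g.coeff_eq_of_coordForm, g.coordForm_transition he he' hz, ← hL]
  rw [real_det, abs_of_nonneg (Complex.normSq_nonneg _), ← Complex.re_ofReal_mul,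
    ← det_sesquilinear_comp]
  rfl

theorem HermitianMetric.re_coordForm_add_leviForm_le {φ : M → ℝ}
    (hφ : ContMDiff 𝓘(ℝ, CSpace n) 𝓘(ℝ, ℝ) 2 φ) (hadm : g.IsAdmissible φ)
    (he : e ∈ atlas (CSpace n) M) {z : CSpace n} (hz : z ∈ e.target) (v : CSpace n) :
    (g.coordForm e z v v).re + leviForm (φ ∘ e.symm) z v ≤
      ((g.coeff e z)⁻¹ * g.deformedCoeff φ e z).trace.re * (g.coordForm e z v v).re := by
  have hφe := contDiffAt_comp_chart_symm hφ he hz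
  have hessian : v.ofLp ⬝ᵥ complexHessian φ e z *ᵥ star v.ofLp =
      ((leviForm (φ ∘ e.symm) z v : ℝ) : ℂ) := by
    have hcomp : ContDiffAt ℝ 2 (Complex.ofRealCLM ∘ φ ∘ e.symm) z :=
      Complex.ofRealCLM.contDiff.contDiffAt.comp z hφe
    rw [dotProduct_mulVec_star_eq_sum, ← Complex.ofRealCLM_apply,
      ← leviForm_clm_comp hφe Complex.ofRealCLM, ← sum_mul_dz_dzbar_eq_leviForm hcomp]
    rfl
  simpa [HermitianMetric.deformedCoeff, Matrix.add_mulVec, g.dotProduct_coeff_mulVec_star, hessian]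
    using re_dotProduct_mulVec_le (g.posDef_coeff he hz) (hadm e he z hz).posSemidef (star v.ofLp)

theorem HermitianMetric.leviForm_comp_chart_symm_le {φ : M → ℝ}
    (hφ : ContMDiff 𝓘(ℝ, CSpace n) 𝓘(ℝ, ℝ) 2 φ) (hadm : g.IsAdmissible φ)
    (he : e ∈ atlas (CSpace n) M) {z : CSpace n} (hz : z ∈ e.target) (v : CSpace n) :
    leviForm (φ ∘ e.symm) z v ≤
      (g.traceDeformed φ (e.symm z) - 1) * (g.coordForm e z v v).re := by
  let e' := chartAt (CSpace n) (e.symm z)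
  have he' : e' ∈ atlas (CSpace n) M := chart_mem_atlas _ _
  have hz' : z ∈ (e.symm.trans e').source := by simp [e', hz]
  have hzt : e.symm.trans e' z ∈ e'.target := ((e.symm.trans e').map_source hz').1
  have levi_transition : leviForm (φ ∘ e.symm) z v =
      leviForm (φ ∘ e'.symm) (e.symm.trans e' z) (fderiv ℂ (e.symm.trans e') z v) := by
    rw [← leviForm_comp (contDiffAt_comp_chart_symm hφ he' hzt)
      ((contDiffAt_transition he he' hz').of_le le_top), leviForm, leviForm,
      (comp_symm_eventuallyEq_comp_transition φ hz').fderiv.fderiv_eq]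
  rw [levi_transition, g.coordForm_transition he he' hz', sub_mul, one_mul, le_sub_iff_add_le']
  exact g.re_coordForm_add_leviForm_le hφ hadm he' hzt _

end Manifold

end Charts

section Volume

theorem restrict_iSup_le {X : Type*} [MeasurableSpace X] {ι : Sort*} {μ : ι → Measure X}
    {ν : Measure X} {s : Set X} (hs : MeasurableSet s) (h : ∀ i, (μ i).restrict s ≤ ν) :
    (⨆ i, μ i).restrict s ≤ ν := by
  have bound : ⨆ i, μ i ≤ ν + (⊤ : Measure X).restrict sᶜ := iSup_le fun i => by
    rw [← Measure.restrict_add_restrict_compl (μ := μ i) hs]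
    exact add_le_add (h i) (Measure.restrict_mono_measure le_top _)
  calc (⨆ i, μ i).restrict s ≤ (ν + (⊤ : Measure X).restrict sᶜ).restrict s :=
        Measure.restrict_mono_measure bound s
    _ = ν.restrict s := by
        rw [Measure.restrict_add, Measure.restrict_restrict hs, Set.inter_compl_self,
          Measure.restrict_empty, add_zero]
    _ ≤ ν := Measure.restrict_le_self

theorem measurableSet_target_inter_preimage_symm {X Y : Type*} [TopologicalSpace X]
    [MeasurableSpace X] [BorelSpace X] [TopologicalSpace Y] [MeasurableSpace Y]
    [BorelSpace Y] (e : OpenPartialHomeomorph X Y) {T : Set X} (hT : MeasurableSet T) :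
    MeasurableSet (e.target ∩ e.symm ⁻¹' T) := by
  convert e.open_target.measurableSet.subtype_image
    ((continuousOn_iff_continuous_domRestrict.1 e.continuousOn_symm).measurable hT) using 1
  ext z
  simp [Set.domRestrict, and_comm]

theorem aemeasurable_symm_withDensity {X Y : Type*} [TopologicalSpace X] [MeasurableSpace X]
    [BorelSpace X] [TopologicalSpace Y] [MeasurableSpace Y] [BorelSpace Y]
    (e : OpenPartialHomeomorph X Y) (μ : Measure Y) (f : Y → ENNReal) :
    AEMeasurable e.symm ((μ.restrict e.target).withDensity f) :=
  (e.continuousOn_symm.aemeasurable e.open_target.measurableSet).mono_ac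
    (withDensity_absolutelyContinuous _ _)

variable {n : ℕ} {M : Type*} [TopologicalSpace M] [ChartedSpace (CSpace n) M]
  (g : HermitianMetric n M) {e e' : OpenPartialHomeomorph M (CSpace n)}

/-- The density of `ωⁿ` with respect to Lebesgue measure in the chart `e`. -/
noncomputable def HermitianMetric.density (e : OpenPartialHomeomorph M (CSpace n))
    (z : CSpace n) : ℝ :=
  n.factorial * 2 ^ n * (g.coeff e z).det.re

theorem HermitianMetric.continuousOn_density (he : e ∈ atlas (CSpace n) M) :
    ContinuousOn (g.density e) e.target := by
  have hcoeff : ContinuousOn (g.coeff e) e.target :=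
    continuousOn_pi.2 fun i => continuousOn_pi.2 fun j => (g.smooth e he i j).continuousOn
  exact continuousOn_const.mul (Complex.continuous_re.comp_continuousOn
    (continuous_id.matrix_det.comp_continuousOn hcoeff))

theorem HermitianMetric.density_pos [IsManifold 𝓘(ℂ, CSpace n) ω M] (he : e ∈ atlas (CSpace n) M)
    {z : CSpace n} (hz : z ∈ e.target) : 0 < g.density e z := by
  have hdet : 0 < (g.coeff e z).det.re := (Complex.lt_def.1 (g.posDef_coeff he hz).det_pos).1
  unfold HermitianMetric.density
  positivity

theorem HermitianMetric.density_transition [IsManifold 𝓘(ℂ, CSpace n) ω M]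
    (he : e ∈ atlas (CSpace n) M) (he' : e' ∈ atlas (CSpace n) M) {z : CSpace n}
    (hz : z ∈ (e.symm.trans e').source) :
    g.density e z = |((fderiv ℂ (e.symm.trans e') z).restrictScalars ℝ).det| *
      g.density e' (e.symm.trans e' z) := by
  rw [HermitianMetric.density, HermitianMetric.density, g.det_coeff_transition he he' hz]
  ring

variable [MeasurableSpace M] [BorelSpace M]

theorem HermitianMetric.localVolume_apply (e : OpenPartialHomeomorph M (CSpace n)) {T : Set M}
    (hT : MeasurableSet T) :
    g.localVolume e T = ∫⁻ z in e.target ∩ e.symm ⁻¹' T, ENNReal.ofReal (g.density e z) := by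
  rw [HermitianMetric.localVolume,
    Measure.map_apply_of_aemeasurable (aemeasurable_symm_withDensity e _ _) hT, withDensity_apply',
    Measure.restrict_restrict' e.open_target.measurableSet, Set.inter_comm]
  rfl

theorem HermitianMetric.restrict_localVolume_le [IsManifold 𝓘(ℂ, CSpace n) ω M]
    (he : e ∈ atlas (CSpace n) M) (he' : e' ∈ atlas (CSpace n) M) :
    (g.localVolume e).restrict e'.source ≤ g.localVolume e' := by
  refine Measure.le_iff.2 fun T hT => ?_
  set s := e.target ∩ e.symm ⁻¹' (T ∩ e'.source)
  have hTm : MeasurableSet (T ∩ e'.source) := hT.inter e'.open_source.measurableSet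
  have hs : MeasurableSet s := measurableSet_target_inter_preimage_symm e hTm
  have hsub : s ⊆ (e.symm.trans e').source := fun z hz => by
    rw [e.symm.trans_source]
    exact ⟨hz.1, hz.2.2⟩
  have hderiv : ∀ z ∈ s, HasFDerivWithinAt (e.symm.trans e')
      ((fderiv ℂ (e.symm.trans e') z).restrictScalars ℝ) s z := fun z hz =>
    (((contDiffAt_transition he he' (hsub hz)).differentiableAt
      (by simp)).hasFDerivAt.restrictScalars ℝ).hasFDerivWithinAt
  rw [Measure.restrict_apply hT, g.localVolume_apply e hTm, g.localVolume_apply e' hT]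
  calc ∫⁻ z in s, ENNReal.ofReal (g.density e z)
      = ∫⁻ z in s, ENNReal.ofReal |((fderiv ℂ (e.symm.trans e') z).restrictScalars ℝ).det| *
          ENNReal.ofReal (g.density e' (e.symm.trans e' z)) :=
        setLIntegral_congr_fun hs fun z hz => by
          rw [g.density_transition he he' (hsub hz), ENNReal.ofReal_mul (abs_nonneg _)]
    _ = ∫⁻ z in e.symm.trans e' '' s, ENNReal.ofReal (g.density e' z) :=
        (lintegral_image_eq_lintegral_abs_det_fderiv_mul volume hs hderiv
          ((e.symm.trans e').injOn.mono hsub) fun z => ENNReal.ofReal (g.density e' z)).symm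
    _ ≤ ∫⁻ z in e'.target ∩ e'.symm ⁻¹' T, ENNReal.ofReal (g.density e' z) := by
        refine lintegral_mono_set ?_
        rintro _ ⟨z, hz, rfl⟩
        refine ⟨((e.symm.trans e').map_source (hsub hz)).1, ?_⟩
        simpa [e'.left_inv hz.2.2] using hz.2.1

theorem HermitianMetric.restrict_volumeMeasure_le [IsManifold 𝓘(ℂ, CSpace n) ω M]
    (he : e ∈ atlas (CSpace n) M) : g.volumeMeasure.restrict e.source ≤ g.localVolume e :=
  restrict_iSup_le e.open_source.measurableSet fun _ =>
    restrict_iSup_le e.open_source.measurableSet fun he' => g.restrict_localVolume_le he' he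

theorem HermitianMetric.isLocallyFiniteMeasure_volumeMeasure [IsManifold 𝓘(ℂ, CSpace n) ω M] :
    IsLocallyFiniteMeasure g.volumeMeasure := by
  refine ⟨fun p => ?_⟩
  let e := chartAt (CSpace n) p
  have he : e ∈ atlas (CSpace n) M := chart_mem_atlas _ _
  obtain ⟨ρ, hρ, hball⟩ := Metric.nhds_basis_closedBall.mem_iff.1
    (e.open_target.mem_nhds (mem_chart_target (CSpace n) p))
  set S := e.source ∩ e ⁻¹' Metric.ball (e p) ρ
  have hS : IsOpen S := e.isOpen_inter_preimage Metric.isOpen_ball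
  refine ⟨S, hS.mem_nhds ⟨mem_chart_source _ p, Metric.mem_ball_self hρ⟩, ?_⟩
  calc g.volumeMeasure S = g.volumeMeasure.restrict e.source S :=
        (Measure.restrict_eq_self _ Set.inter_subset_left).symm
    _ ≤ g.localVolume e S := g.restrict_volumeMeasure_le he S
    _ = ∫⁻ z in e.target ∩ e.symm ⁻¹' S, ENNReal.ofReal (g.density e z) :=
        g.localVolume_apply e hS.measurableSet
    _ ≤ ∫⁻ z in Metric.closedBall (e p) ρ, ENNReal.ofReal (g.density e z) := by
        refine lintegral_mono_set fun z hz => Metric.ball_subset_closedBall ?_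
        simpa [e.right_inv hz.1] using hz.2.2
    _ < ⊤ := (((g.continuousOn_density he).mono hball).integrableOn_compact
        (isCompact_closedBall _ _)).lintegral_lt_top

theorem HermitianMetric.exists_smul_map_symm_le_volumeMeasure [IsManifold 𝓘(ℂ, CSpace n) ω M]
    (he : e ∈ atlas (CSpace n) M) {K : Set (CSpace n)} (hK : IsCompact K) (hKe : K ⊆ e.target) :
    ∃ δ : ℝ, 0 < δ ∧ ENNReal.ofReal δ •
      ((volume : Measure (CSpace n)).restrict K).map e.symm ≤ g.volumeMeasure := by
  obtain ⟨δ, hδ, hδK⟩ : ∃ δ : ℝ, 0 < δ ∧ ∀ z ∈ K, δ ≤ g.density e z :=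
    hK.exists_forall_le' ((g.continuousOn_density he).mono hKe)
      fun z hz => g.density_pos he (hKe hz)
  refine ⟨δ, hδ, le_trans ?_ (le_iSup₂_of_le e he le_rfl)⟩
  have hν : ENNReal.ofReal δ • (volume : Measure (CSpace n)).restrict K ≤
      (volume.restrict e.target).withDensity fun z => ENNReal.ofReal (g.density e z) :=
    calc ENNReal.ofReal δ • (volume : Measure (CSpace n)).restrict K
        = (volume.restrict K).withDensity fun _ => ENNReal.ofReal δ := (withDensity_const _).symm
      _ ≤ (volume.restrict K).withDensity fun z => ENNReal.ofReal (g.density e z) :=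
          withDensity_mono <| (ae_restrict_mem hK.measurableSet).mono fun z hz =>
            ENNReal.ofReal_le_ofReal (hδK z hz)
      _ ≤ (volume.restrict e.target).withDensity fun z => ENNReal.ofReal (g.density e z) :=
          Measure.le_iff.2 fun T hT => by
            rw [withDensity_apply _ hT, withDensity_apply _ hT]
            exact lintegral_mono' (Measure.restrict_mono_measure
              (Measure.restrict_mono_set _ hKe) T) le_rfl
  rw [← Measure.map_smul]
  exact Measure.map_mono_of_aemeasurable hν (aemeasurable_symm_withDensity e _ _)

end Volume

section LowerBound

open InnerProductSpace Laplacian Metric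

theorem neg_mul_leviForm_le_leviForm_exp {E : Type*} [NormedAddCommGroup E] [NormedSpace ℝ E]
    [NormedSpace ℂ E] {f : E → ℝ} {z : E} (hf : ContDiffAt ℝ 2 f z) (q m : ℝ) (v : E) :
    -q * Real.exp (-q * (f z - m)) * leviForm f z v ≤
      leviForm (fun y => Real.exp (-q * (f y - m))) z v := by
  set h : ℝ → ℝ := fun s => Real.exp (-q * (s - m))
  have hderiv : deriv h = fun s => -q * h s := funext fun s => by
    rw [(((hasDerivAt_id' s).sub_const m).const_mul (-q)).exp.deriv]
    ring
  have hconv : 0 ≤ deriv (deriv h) (f z) := by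
    rw [hderiv, deriv_const_mul_field, hderiv, ← mul_assoc]
    exact mul_nonneg (mul_self_nonneg _) (Real.exp_nonneg _)
  have hchain := deriv_mul_leviForm_le_leviForm_comp (by fun_prop) hf hconv v
  rwa [hderiv] at hchain

variable {n : ℕ} {M : Type*} [TopologicalSpace M] [ChartedSpace (CSpace n) M]

/-- `φ` is a `C²` potential with `g' > 0` satisfying `tr_g g' ≤ C e^{A(φ - inf φ)}`. -/
structure HermitianMetric.SecondOrderEstimate (g : HermitianMetric n M) (A C : ℝ)
    (φ : M → ℝ) : Prop where
  contMDiff : ContMDiff 𝓘(ℝ, CSpace n) 𝓘(ℝ, ℝ) 2 φ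
  isAdmissible : g.IsAdmissible φ
  traceDeformed_le : ∀ p, g.traceDeformed φ p ≤ C * Real.exp (A * (φ p - ⨅ q, φ q))

/-- The function `e^{-q(φ - inf φ)}`, to which the sub-mean-value inequality is applied. -/
noncomputable def expGap {X : Type*} (q : ℝ) (φ : X → ℝ) (x : X) : ℝ :=
  Real.exp (-q * (φ x - ⨅ y, φ y))

theorem expGap_anti {X : Type*} {φ : X → ℝ} (hφ : BddBelow (Set.range φ)) {q q' : ℝ} (h : q ≤ q')
    (x : X) : expGap q' φ x ≤ expGap q φ x := by
  have := ciInf_le hφ x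
  exact Real.exp_le_exp.2 (by nlinarith)

theorem exp_neg_mul_eq_mul_expGap {X : Type*} (α : ℝ) (φ : X → ℝ) (x : X) :
    Real.exp (-α * φ x) = Real.exp (-α * ⨅ y, φ y) * expGap α φ x := by
  rw [expGap, ← Real.exp_add]
  ring_nf

namespace HermitianMetric

variable {g : HermitianMetric n M} {A C q : ℝ} {φ : M → ℝ}

theorem SecondOrderEstimate.continuous_expGap (hφ : g.SecondOrderEstimate A C φ) :
    Continuous (expGap q φ) := by
  have := hφ.contMDiff.continuous
  unfold expGap
  fun_prop

variable [CompactSpace M]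

theorem SecondOrderEstimate.bddBelow (hφ : g.SecondOrderEstimate A C φ) :
    BddBelow (Set.range φ) :=
  (isCompact_range hφ.contMDiff.continuous).bddBelow

variable [IsManifold 𝓘(ℂ, CSpace n) ω M] {e : OpenPartialHomeomorph M (CSpace n)}

theorem SecondOrderEstimate.leviForm_expGap_ge (hφ : g.SecondOrderEstimate A C φ) (hq : 0 ≤ q)
    (hAq : A ≤ q) (he : e ∈ atlas (CSpace n) M) {z : CSpace n} (hz : z ∈ e.target) (i : Fin n) :
    -(q * |C| * (g.coeff e z i i).re) ≤
      leviForm (expGap q φ ∘ e.symm) z (EuclideanSpace.single i 1) := by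
  set t := φ (e.symm z) - ⨅ p, φ p
  have ht : 0 ≤ t := sub_nonneg.2 (ciInf_le hφ.bddBelow _)
  have hG : 0 ≤ (g.coeff e z i i).re :=
    (Complex.lt_def.1 (g.posDef_coeff he hz).diag_pos).1.le
  have hlevi : leviForm (φ ∘ e.symm) z (EuclideanSpace.single i 1) ≤
      |C| * Real.exp (A * t) * (g.coeff e z i i).re := by
    refine (g.leviForm_comp_chart_symm_le hφ.contMDiff hφ.isAdmissible he hz _).trans
      (mul_le_mul_of_nonneg_right ?_ hG)
    have := mul_le_mul_of_nonneg_right (le_abs_self C) (Real.exp_nonneg (A * t))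
    linarith [hφ.traceDeformed_le (e.symm z)]
  have hexp : Real.exp (-q * t) * Real.exp (A * t) ≤ 1 := by
    rw [← Real.exp_add, Real.exp_le_one_iff]
    nlinarith
  refine le_trans ?_
    (neg_mul_leviForm_le_leviForm_exp (contDiffAt_comp_chart_symm hφ.contMDiff he hz)
      q (⨅ p, φ p) _)
  rw [neg_mul, neg_mul, neg_le_neg_iff]
  calc q * Real.exp (-q * t) * leviForm (φ ∘ e.symm) z (EuclideanSpace.single i 1)
      ≤ q * Real.exp (-q * t) * (|C| * Real.exp (A * t) * (g.coeff e z i i).re) := by gcongr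
    _ = q * |C| * (g.coeff e z i i).re * (Real.exp (-q * t) * Real.exp (A * t)) := by ring
    _ ≤ q * |C| * (g.coeff e z i i).re := mul_le_of_le_one_right (by positivity) hexp

theorem exists_laplacian_expGap_ge (g : HermitianMetric n M) (A C : ℝ) (hq : 0 ≤ q) (hAq : A ≤ q)
    (he : e ∈ atlas (CSpace n) M) {K : Set (CSpace n)} (hK : IsCompact K) (hKe : K ⊆ e.target) :
    ∃ B : ℝ, 0 ≤ B ∧ ∀ φ, g.SecondOrderEstimate A C φ → ∀ z ∈ K,
      -B ≤ Δ (expGap q φ ∘ e.symm) z := by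
  have htrace : ContinuousOn (fun z => 4 * ∑ i, q * |C| * (g.coeff e z i i).re) K :=
    continuousOn_const.mul <| continuousOn_finsetSum _ fun i _ => continuousOn_const.mul <|
      Complex.continuous_re.comp_continuousOn ((g.smooth e he i i).continuousOn.mono hKe)
  obtain ⟨B, hB⟩ := hK.bddAbove_image htrace
  refine ⟨max B 0, le_max_right _ _, fun φ hφ z hz => ?_⟩
  rw [laplacian_eq_sum_leviForm, smul_eq_mul]
  calc -max B 0 ≤ -(4 * ∑ i, q * |C| * (g.coeff e z i i).re) :=
        neg_le_neg (le_max_of_le_left (hB (Set.mem_image_of_mem _ hz)))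
    _ = 4 * ∑ i, -(q * |C| * (g.coeff e z i i).re) := by rw [Finset.sum_neg_distrib, mul_neg]
    _ ≤ 4 * ∑ i, leviForm (expGap q φ ∘ e.symm) z (EuclideanSpace.single i 1) := by
        gcongr with i
        exact hφ.leviForm_expGap_ge hq hAq he (hKe hz) i

variable [MeasurableSpace M] [BorelSpace M]

omit [CompactSpace M] in
theorem exists_mul_setIntegral_le_integral (g : HermitianMetric n M)
    (he : e ∈ atlas (CSpace n) M) {K : Set (CSpace n)} (hK : IsCompact K) (hKe : K ⊆ e.target) :
    ∃ δ : ℝ, 0 < δ ∧ ∀ f : M → ℝ, 0 ≤ f → Integrable f g.volumeMeasure →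
      δ * ∫ z in K, f (e.symm z) ≤ ∫ p, f p ∂g.volumeMeasure := by
  obtain ⟨δ, hδ, hle⟩ := g.exists_smul_map_symm_le_volumeMeasure he hK hKe
  refine ⟨δ, hδ, fun f hf0 hf => ?_⟩
  have hmeas : AEStronglyMeasurable f ((volume.restrict K).map e.symm) :=
    (hf.mono_measure hle).aestronglyMeasurable.mono_ac
      (Measure.absolutelyContinuous_smul (ENNReal.ofReal_pos.2 hδ).ne')
  have hsymm : AEMeasurable e.symm (volume.restrict K) :=
    (e.continuousOn_symm.mono hKe).aemeasurable hK.measurableSet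
  calc δ * ∫ z in K, f (e.symm z)
      = ∫ p, f p ∂ENNReal.ofReal δ • (volume.restrict K).map e.symm := by
        rw [integral_smul_measure, integral_map hsymm hmeas, ENNReal.toReal_ofReal hδ.le,
          smul_eq_mul]
    _ ≤ ∫ p, f p ∂g.volumeMeasure :=
        integral_mono_measure hle (Filter.Eventually.of_forall hf0) hf

theorem SecondOrderEstimate.integrable_expGap (hφ : g.SecondOrderEstimate A C φ) :
    Integrable (expGap q φ) g.volumeMeasure := by
  have := g.isLocallyFiniteMeasure_volumeMeasure
  exact hφ.continuous_expGap.integrable_of_hasCompactSupport (HasCompactSupport.of_compactSpace _)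

theorem exists_nhds_pos_le_integral_expGap (g : HermitianMetric n M) (A C : ℝ) {α : ℝ} (hα : 0 ≤ α)
    (p : M) :
    ∃ S ∈ nhds p, ∃ c : ℝ, 0 < c ∧ ∀ φ, g.SecondOrderEstimate A C φ →
      ∀ x ∈ S, φ x = ⨅ y, φ y → c ≤ ∫ y, expGap α φ y ∂g.volumeMeasure := by
  let e := chartAt (CSpace n) p
  have he : e ∈ atlas (CSpace n) M := chart_mem_atlas _ _
  obtain ⟨R, hR, hball⟩ := nhds_basis_closedBall.mem_iff.1
    (e.open_target.mem_nhds (mem_chart_target (CSpace n) p))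
  have hcompact := isCompact_closedBall (e p) R
  have hq : α ≤ max α A := le_max_left _ _
  obtain ⟨δ, hδ, hvol⟩ := g.exists_mul_setIntegral_le_integral he hcompact hball
  obtain ⟨B, hB, hlap⟩ := g.exists_laplacian_expGap_ge A C (hα.trans hq) (le_max_right α A)
    he hcompact hball
  obtain ⟨c, hc, hmean⟩ := exists_pos_le_setIntegral_closedBall volume (e p) hR hB
  refine ⟨e.source ∩ e ⁻¹' ball (e p) (R / 2), (e.isOpen_inter_preimage isOpen_ball).mem_nhds
    ⟨mem_chart_source _ p, mem_ball_self (half_pos hR)⟩, δ * c, by positivity, ?_⟩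
  rintro φ hφ x ⟨hxe, hx⟩ hmin
  have hsmooth : ContDiffOn ℝ 2 (expGap (max α A) φ ∘ e.symm) e.target := fun z hz =>
    (((contDiffAt_comp_chart_symm hφ.contMDiff he hz).sub contDiffAt_const).const_smul
      (-max α A)).exp.contDiffWithinAt
  have hone : 1 ≤ (expGap (max α A) φ ∘ e.symm) (e x) := by
    simp [e.left_inv hxe, expGap, hmin]
  calc δ * c ≤ δ * ∫ z in closedBall (e p) R, expGap (max α A) φ (e.symm z) := by
        gcongr
        exact hmean _ _ e.open_target hball hsmooth (fun _ _ => Real.exp_nonneg _) (hlap φ hφ)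
          (e x) (ball_subset_closedBall hx) hone
    _ ≤ ∫ y, expGap (max α A) φ y ∂g.volumeMeasure :=
        hvol _ (fun _ => Real.exp_nonneg _) hφ.integrable_expGap
    _ ≤ ∫ y, expGap α φ y ∂g.volumeMeasure :=
        integral_mono hφ.integrable_expGap hφ.integrable_expGap (expGap_anti hφ.bddBelow hq)

theorem exists_pos_le_integral_expGap (g : HermitianMetric n M) (A C : ℝ) {α : ℝ} (hα : 0 ≤ α) :
    ∃ c : ℝ, 0 < c ∧ ∀ φ, g.SecondOrderEstimate A C φ →
      ∀ x, φ x = ⨅ y, φ y → c ≤ ∫ y, expGap α φ y ∂g.volumeMeasure := by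
  suffices h : ∃ c : ℝ, 0 < c ∧ ∀ φ, g.SecondOrderEstimate A C φ →
      ∀ x ∈ Set.univ, φ x = ⨅ y, φ y → c ≤ ∫ y, expGap α φ y ∂g.volumeMeasure by
    simpa using h
  refine isCompact_univ.induction_on ⟨1, one_pos, by simp⟩ ?mono ?union ?nhds
  case mono =>
    rintro S T hST ⟨c, hc, h⟩
    exact ⟨c, hc, fun φ hφ x hx => h φ hφ x (hST hx)⟩
  case union =>
    rintro S T ⟨c, hc, h⟩ ⟨c', hc', h'⟩
    refine ⟨min c c', lt_min hc hc', fun φ hφ x hx hmin => ?_⟩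
    rcases hx with hx | hx
    · exact (min_le_left _ _).trans (h φ hφ x hx hmin)
    · exact (min_le_right _ _).trans (h' φ hφ x hx hmin)
  case nhds =>
    intro p _
    obtain ⟨S, hS, h⟩ := g.exists_nhds_pos_le_integral_expGap A C hα p
    exact ⟨S, mem_nhdsWithin_of_mem_nhds hS, h⟩

variable [Nonempty M]

theorem toReal_volumeMeasure_univ_pos (g : HermitianMetric n M) :
    0 < (g.volumeMeasure Set.univ).toReal := by
  have := g.isLocallyFiniteMeasure_volumeMeasure
  obtain ⟨p⟩ := ‹Nonempty M›
  let e := chartAt (CSpace n) p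
  obtain ⟨R, hR, hball⟩ := nhds_basis_closedBall.mem_iff.1
    (e.open_target.mem_nhds (mem_chart_target (CSpace n) p))
  obtain ⟨δ, hδ, hvol⟩ := g.exists_mul_setIntegral_le_integral (chart_mem_atlas _ p)
    (isCompact_closedBall (e p) R) hball
  have hRpos : 0 < volume.real (closedBall (e p) R) :=
    ENNReal.toReal_pos (measure_closedBall_pos _ _ hR).ne' measure_closedBall_lt_top.ne
  have hle := hvol 1 (fun _ => zero_le_one) (integrable_const 1)
  simp only [Pi.one_apply, integral_const, smul_eq_mul, mul_one, measureReal_restrict_apply_univ]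
    at hle
  exact (mul_pos hδ hRpos).trans_le hle

theorem exists_pos_le_integral_expGap_normalizedVolume (g : HermitianMetric n M)
    (A C : ℝ) {α : ℝ} (hα : 0 ≤ α) :
    ∃ c : ℝ, 0 < c ∧ ∀ φ, g.SecondOrderEstimate A C φ →
      c ≤ ∫ p, expGap α φ p ∂g.normalizedVolume := by
  obtain ⟨c, hc, hbound⟩ := g.exists_pos_le_integral_expGap A C hα
  have hV := g.toReal_volumeMeasure_univ_pos
  refine ⟨(g.volumeMeasure Set.univ).toReal⁻¹ * c, by positivity, fun φ hφ => ?_⟩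
  obtain ⟨x, hx⟩ := (isCompact_range hφ.contMDiff.continuous).sInf_mem (Set.range_nonempty φ)
  rw [normalizedVolume, integral_smul_measure, ENNReal.toReal_inv, smul_eq_mul]
  gcongr
  exact hbound φ hφ x hx

end HermitianMetric

end LowerBound

end HermitianGeometry

open HermitianGeometry in
theorem lemma3p1_general (n : ℕ) (M : Type*) [TopologicalSpace M] [ChartedSpace (CSpace n) M]
    [IsManifold 𝓘(ℂ, CSpace n) ω M] [CompactSpace M] [Nonempty M] [MeasurableSpace M]
    [BorelSpace M] (g : HermitianMetric n M) (A C α : ℝ) (hα : 0 < α) :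
    ∃ Cα : ℝ, ∀ φ : M → ℝ, g.SecondOrderEstimate A C φ →
      -(⨅ p, φ p) ≤
        Cα + (1 / α) * Real.log (∫ p, Real.exp (-α * φ p) ∂g.normalizedVolume) := by
  obtain ⟨c, hc, hbound⟩ := g.exists_pos_le_integral_expGap_normalizedVolume A C hα.le
  refine ⟨-(1 / α * Real.log c), fun φ hφ => ?_⟩
  set m := ⨅ p, φ p
  have hlog : Real.log c ≤ Real.log (∫ p, expGap α φ p ∂g.normalizedVolume) :=
    Real.log_le_log hc (hbound φ hφ)
  have hintegral : Real.log (∫ p, Real.exp (-α * φ p) ∂g.normalizedVolume) =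
      -α * m + Real.log (∫ p, expGap α φ p ∂g.normalizedVolume) := by
    simp_rw [exp_neg_mul_eq_mul_expGap α φ]
    rw [integral_const_mul, Real.log_mul (Real.exp_ne_zero _) (hc.trans_le (hbound φ hφ)).ne',
      Real.log_exp]
  calc -m = -(1 / α * Real.log c) + 1 / α * (-α * m + Real.log c) := by
        field_simp
        ring
    _ ≤ -(1 / α * Real.log c) +
          1 / α * Real.log (∫ p, Real.exp (-α * φ p) ∂g.normalizedVolume) := by
        rw [hintegral]
        gcongr

/-- `M` is a compact complex manifold of dimension `n ≥ 2` with a Hermitian metric `g`, and `A`, `C`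
are the constants of the second-order estimate `tr_g g' ≤ C e^{A(φ - inf φ)}`. The constant `Cα`
depends only on `(M, g)`, `A`, `C` and `α`, not on `φ`. -/
theorem lemma3p1 (n : ℕ) (hn : 2 ≤ n) (M : Type*) [TopologicalSpace M]
    [ChartedSpace (HermitianGeometry.CSpace n) M]
    [IsManifold 𝓘(ℂ, HermitianGeometry.CSpace n) ω M]
    [T2Space M] [CompactSpace M] [Nonempty M] [MeasurableSpace M] [BorelSpace M]
    (g : HermitianGeometry.HermitianMetric n M) (A C α : ℝ) (hα : 0 < α) :
    ∃ Cα : ℝ, ∀ φ : M → ℝ,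
      ContMDiff 𝓘(ℝ, HermitianGeometry.CSpace n) 𝓘(ℝ, ℝ) ∞ φ →
      (⨆ p, φ p) = 0 →
      g.IsAdmissible φ →
      (∀ p, g.traceDeformed φ p ≤ C * Real.exp (A * (φ p - ⨅ q, φ q))) →
      -(⨅ p, φ p) ≤
        Cα + (1 / α) * Real.log (∫ p, Real.exp (-α * φ p) ∂g.normalizedVolume) := by
  obtain ⟨Cα, h⟩ := lemma3p1_general n M g A C α hα
  exact ⟨Cα, fun φ hφ _ hadm htr => h φ ⟨hφ.of_le ENat.LEInfty.out, hadm, htr⟩⟩
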